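/- \textbf{Setting.} All graphs are finite, simple and unweighted, with vertex set $\{1,\dots,n\}$, $n$ being known to the algorithm. For vertices $u,v$ of $G$ in the same connected component, the \emph{effective resistance} is $r_G(u,v)=(\vec 1_u-\vec 1_v)^{T}L^{+}(\vec 1_u-\vec 1_v)$, where $L^+$ is the Moore--Penrose pseudoinverse of the graph Laplacian $L=D-A$; for vertices in different components $r_G(u,v)=\infty$. The unit ball at $v$ is $B_G(v)=\{u : r_G(u,v)\le 1\}$, and the \emph{ER density} of $G$ is $\rho(G)=\max_v|B_G(v)|$. A \emph{graph property} $P$ is a set of graphs closed under isomorphism. For a degree bound $d$ and $\varepsilon>0$, an $n$-vertex graph is \emph{$\varepsilon$-far} from $P$ if more than $\varepsilon d n$ edge insertions and deletions are required to make it satisfy $P$. A \emph{randomized oracle algorithm} proceeds by internal steps, uniform random choices from finite nonempty sets, and adaptive oracle queries, and halts with ``accept'' or ``reject''; its running time counts all of these steps (each costing one unit), in the worst case over the random choices, and its number of queries counts the oracle queries only, again in the worst case over the random choices. A \emph{property tester for $P$ in the bounded-degree model} with degree bound $d$ is given $n$ and $\varepsilon>0$ and has query access to incidence lists of a graph $G$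 of maximum degree at most $d$: a query $(v,i)$ with $1\le i\le d$ returns the $i$-th neighbor of $v$ (in some arbitrary fixed order), or $\bot$ if $v$ has fewer than $i$ neighbors. For every such $G$ and every ordering of the incidence lists, it accepts with probability at least $c$ if $G$ satisfies $P$ and rejects with probability at least $s$ if $G$ is $\varepsilon$-far from $P$ (e.g. $c=s=2/3$, or $c=1$, $s=2/3$ for one-sided error). It has running time $f(\varepsilon,n)$ if its running time is at most $f(\varepsilon,n)$ for all $n$, all $\varepsilon>0$, all such $G$ and all such orderings. A \emph{property tester for $P$ with ER queries} (for degree bound $d$) is given $n$ and $\varepsilon>0$, may query $r_G(u,v)$ for pairs of vertices $u,v$, and satisfies the same acceptance and rejection requirements, with the same $c$ and $s$, for every $G$ of maximum degree at most $d$. \textbf{Theorem.} There is an absolute constant $C>0$ such that the following holds. Let $d\in\mathbb N$, let $P$ be a graph property, and let $A$ be a property tester for $P$ in the bounded-degree model with degree bound $d$ and with running time $f(\varepsilon,n)$. Then there is a property tester for $P$ with ER queries, with the same degree bound and the same acceptance and rejection guarantees $c,s$, that for all $n$, all $\varepsilon>0$ and every $n$-vertex graph $G$ of maximum degree at most $d$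 makes at most $C\cdot f(\varepsilon,n)\cdot(n+\rho(G)^2)$ effective resistance queries on $G$. -/

import Mathlib

open scoped ENNReal

noncomputable section

/-! ### Effective resistance -/

/-- `X` is the (Moore-Penrose) pseudoinverse of the real matrix `M`. -/
structure IsPseudoinverse {V : Type*} [Fintype V] (M X : Matrix V V ℝ) : Prop where
  mul_mul_self : M * X * M = M
  self_mul_mul : X * M * X = X
  transpose_left : (M * X).transpose = M * X
  transpose_right : (X * M).transpose = X * M

theorem exists_isPseudoinverse {V : Type*} [Fintype V] [DecidableEq V] {M : Matrix V V ℝ}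
    (hM : M.IsHermitian) : ∃ X, IsPseudoinverse M X := by
  obtain ⟨U, D, h1, hMD⟩ : ∃ (U : Matrix V V ℝ) (D : V → ℝ),
      U.transpose * U = 1 ∧ M = U * Matrix.diagonal D * U.transpose := by
    refine ⟨(hM.eigenvectorUnitary : Matrix V V ℝ), hM.eigenvalues, ?_, ?_⟩
    · have := Unitary.coe_star_mul_self hM.eigenvectorUnitary
      simpa [Matrix.star_eq_conjTranspose] using this
    · have := hM.spectral_theorem
      rw [Unitary.conjStarAlgAut_apply] at this
      simpa [Matrix.star_eq_conjTranspose, Function.comp_def] using this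
  have key : ∀ a b : V → ℝ, (U * Matrix.diagonal a * U.transpose) *
      (U * Matrix.diagonal b * U.transpose)
        = U * Matrix.diagonal (fun i => a i * b i) * U.transpose := by
    intro a b
    calc _ = U * Matrix.diagonal a * (U.transpose * U) * Matrix.diagonal b * U.transpose := by
          simp only [Matrix.mul_assoc]
      _ = _ := by
          rw [h1, Matrix.mul_one, Matrix.mul_assoc U, Matrix.diagonal_mul_diagonal]
  have tr : ∀ a : V → ℝ, (U * Matrix.diagonal a * U.transpose).transpose
      = U * Matrix.diagonal a * U.transpose := by
    intro a
    rw [Matrix.transpose_mul, Matrix.transpose_mul, Matrix.transpose_transpose,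
      Matrix.diagonal_transpose, Matrix.mul_assoc]
  refine ⟨U * Matrix.diagonal (fun i => (D i)⁻¹) * U.transpose, ?_, ?_, ?_, ?_⟩ <;> subst hMD
  · rw [key, key]
    have h : (fun i => D i * (D i)⁻¹ * D i) = D := funext fun i => mul_inv_mul_cancel (D i)
    rw [h]
  · rw [key, key]
    have h : (fun i => (D i)⁻¹ * D i * (D i)⁻¹) = fun i => (D i)⁻¹ :=
      funext fun i => by simpa using mul_inv_mul_cancel (D i)⁻¹
    rw [h]
  · rw [key, tr]
  · rw [key, tr]

/-- The Laplacian `L = D - A` of an unweighted graph. -/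
def laplacian {n : ℕ} (G : SimpleGraph (Fin n)) : Matrix (Fin n) (Fin n) ℝ :=
  open Classical in G.lapMatrix ℝ

theorem laplacian_isHermitian {n : ℕ} (G : SimpleGraph (Fin n)) : (laplacian G).IsHermitian := by
  classical
  exact G.isHermitian_lapMatrix ℝ

/-- The pseudoinverse `L⁺` of the Laplacian. -/
def laplacianPinv {n : ℕ} (G : SimpleGraph (Fin n)) : Matrix (Fin n) (Fin n) ℝ :=
  Classical.choose (exists_isPseudoinverse (laplacian_isHermitian G))

/-- The effective resistance `(1_u - 1_v)ᵀ L⁺ (1_u - 1_v)` between two vertices; it is infinite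
between different connected components. -/
def effRes {n : ℕ} (G : SimpleGraph (Fin n)) (u v : Fin n) : EReal :=
  open Classical in
  if G.Reachable u v then
    (((Pi.single u 1 - Pi.single v 1 : Fin n → ℝ) ⬝ᵥ
      (laplacianPinv G).mulVec (Pi.single u 1 - Pi.single v 1) : ℝ) : EReal)
  else ⊤

/-- The unit ball around `v` in the effective resistance metric. -/
def erBall {n : ℕ} (G : SimpleGraph (Fin n)) (v : Fin n) : Set (Fin n) :=
  {u | effRes G u v ≤ 1}

/-- The ER density: the maximum size of a unit ball. -/
def erDensity {n : ℕ} (G : SimpleGraph (Fin n)) : ℕ :=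
  Finset.univ.sup fun v => (erBall G v).ncard

/-! ### Randomized algorithms with oracle access -/

/-- The computation of a randomized, adaptive algorithm with access to an oracle that answers
queries in `Q` by elements of `R`. It halts with an output in `β`, or performs an internal
step, or draws a uniformly random element of `Fin (k + 1)`, or queries the oracle, and
continues depending on the outcome. -/
inductive OracleAlg (Q R β : Type) : Type
  | halt (b : β) : OracleAlg Q R β
  | step (next : OracleAlg Q R β) : OracleAlg Q R β
  | random (k : ℕ) (next : Fin (k + 1) → OracleAlg Q R β) : OracleAlg Q R β
  | query (q : Q) (next : R → OracleAlg Q R β) : OracleAlg Q R β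

namespace OracleAlg

variable {Q R β : Type}

/-- The distribution of the output when the oracle is `O`. -/
def output (O : Q → R) : OracleAlg Q R β → PMF β
  | halt b => PMF.pure b
  | step next => next.output O
  | random k next => (PMF.uniformOfFintype (Fin (k + 1))).bind fun i => (next i).output O
  | query q next => (next (O q)).output O

/-- The running time with oracle `O`, in the worst case over the random choices: every internal
step, random draw and oracle query takes one unit of time. -/
def time (O : Q → R) : OracleAlg Q R β → ℕ
  | halt _ => 0
  | step next => next.time O + 1
  | random _ next => (Finset.univ.sup fun i => (next i).time O) + 1
  | query q next => (next (O q)).time O + 1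

/-- The number of queries to the oracle `O`, in the worst case over the random choices. -/
def queries (O : Q → R) : OracleAlg Q R β → ℕ
  | halt _ => 0
  | step next => next.queries O
  | random _ next => Finset.univ.sup fun i => (next i).queries O
  | query q next => (next (O q)).queries O + 1

end OracleAlg

/-! ### Property testing -/

/-- A graph property: a set of finite graphs closed under isomorphism. -/
structure GraphProperty where
  Holds : ∀ {n : ℕ}, SimpleGraph (Fin n) → Prop
  iso : ∀ {m n : ℕ} (G : SimpleGraph (Fin m)) (H : SimpleGraph (Fin n)),
    Nonempty (G ≃g H) → Holds G → Holds H

/-- All degrees of `G` are at most `d`. -/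
def DegreeAtMost (d : ℕ) {n : ℕ} (G : SimpleGraph (Fin n)) : Prop :=
  ∀ v, (G.neighborSet v).ncard ≤ d

/-- More than `ε d n` edge modifications (insertions and deletions) are required to turn the
`n`-vertex graph `G` into a graph with property `P`. -/
def IsFar (P : GraphProperty) (d : ℕ) (ε : ℝ) {n : ℕ} (G : SimpleGraph (Fin n)) : Prop :=
  ∀ H : SimpleGraph (Fin n), P.Holds H →
    ε * d * n < ((symmDiff G.edgeSet H.edgeSet).ncard : ℝ)

/-- `g` is an incidence-list representation of `G`: `g (v, i)` is the `i`-th neighbor of `v`, in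
an arbitrary order without repetition, and `none` if `v` has too few neighbors. -/
structure IsIncidenceFunction {n d : ℕ} (G : SimpleGraph (Fin n))
    (g : Fin n × Fin d → Option (Fin n)) : Prop where
  adj_iff : ∀ v u, G.Adj v u ↔ ∃ i, g (v, i) = some u
  inj : ∀ v i j u, g (v, i) = some u → g (v, j) = some u → i = j
  padded : ∀ v i j, i ≤ j → g (v, i) = none → g (v, j) = none

/-- An algorithm in the bounded-degree model: it is given the number `n` of vertices and the
proximity parameter `ε`, and queries entries of the incidence lists. -/
abbrev BoundedDegreeAlg (d : ℕ) : Type :=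
  ∀ n : ℕ, ℝ → OracleAlg (Fin n × Fin d) (Option (Fin n)) Bool

/-- An algorithm with effective resistance queries: it is given `n` and `ε`, and queries the
effective resistance of pairs of vertices. -/
abbrev ERAlg : Type :=
  ∀ n : ℕ, ℝ → OracleAlg (Fin n × Fin n) EReal Bool

/-- The effective resistance oracle of `G`. -/
def erOracle {n : ℕ} (G : SimpleGraph (Fin n)) : Fin n × Fin n → EReal :=
  fun q => effRes G q.1 q.2

/-- `A` is a property testing algorithm for `P` in the bounded-degree model: it accepts every graph
with property `P` with probability at least `c`, and rejects every graph that is `ε`-far from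
`P` with probability at least `s`. -/
def IsBoundedDegreeTester (d : ℕ) (P : GraphProperty) (c s : ℝ≥0∞) (A : BoundedDegreeAlg d) :
    Prop :=
  ∀ (n : ℕ) (ε : ℝ), 0 < ε → ∀ G : SimpleGraph (Fin n), DegreeAtMost d G →
    ∀ g, IsIncidenceFunction G g →
      (P.Holds G → c ≤ (A n ε).output g true) ∧ (IsFar P d ε G → s ≤ (A n ε).output g false)

/-- `A` has running time `f(ε, n)`. -/
def HasRunningTime (d : ℕ) (A : BoundedDegreeAlg d) (f : ℝ → ℕ → ℝ) : Prop :=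
  ∀ (n : ℕ) (ε : ℝ), 0 < ε → ∀ G : SimpleGraph (Fin n), DegreeAtMost d G →
    ∀ g, IsIncidenceFunction G g → ((A n ε).time g : ℝ) ≤ f ε n

/-- `B` is a property testing algorithm for `P` on graphs of maximum degree at most `d`, with
effective resistance queries. -/
def IsERTester (d : ℕ) (P : GraphProperty) (c s : ℝ≥0∞) (B : ERAlg) : Prop :=
  ∀ (n : ℕ) (ε : ℝ), 0 < ε → ∀ G : SimpleGraph (Fin n), DegreeAtMost d G →
    (P.Holds G → c ≤ (B n ε).output (erOracle G) true) ∧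
      (IsFar P d ε G → s ≤ (B n ε).output (erOracle G) false)

end

/-! Each incidence query at `v` is simulated exactly: query `r(u,v)` for all `u`, then all pairs
inside the unit ball of `v`. This costs at most `n + ρ²` queries, and the answers determine the
neighbors of `v` (`adj_iff_of_effRes_eq`).

To see this, let `G` and `H` give the same answers and let `w` be the difference of the columns `L_G
e_v` and `L_H e_v`. Both columns sum to zero and live on the common ball, since adjacent vertices
have resistance at most 1 (`mem_erBall_of_adj`). On zero-sum vectors the form of `L⁺` is `-1/2`
times the form of the resistance matrix (`sum_mul_pinvResistance`), so on the ball it is the same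
for `G` and `H`. Hence `wᵀ L_G⁺ w = (L_G e_v)ᵀ L_G⁺ w - (L_H e_v)ᵀ L_H⁺ w = w_v - w_v = 0`, and
positive semidefiniteness gives `w = 0`. -/

open Matrix

/-! ### The pseudoinverse of a Laplacian -/

namespace IsPseudoinverse

variable {V : Type*} [Fintype V] {L X : Matrix V V ℝ}

/-- Transpose `L * X * L = L` and use that `L * X` is symmetric. It puts every residual `z - L X z`
into the kernel of `L`. -/
theorem self_mul_self_mul (h : IsPseudoinverse L X) (hL : L.transpose = L) :
    L * (L * X) = L := by
  have h1 : X.transpose * L = L * X := by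
    simpa [Matrix.transpose_mul, hL] using h.transpose_left
  have h2 := congrArg Matrix.transpose h.mul_mul_self
  rw [Matrix.transpose_mul, Matrix.transpose_mul, hL, h1] at h2
  exact h2

theorem commute (h : IsPseudoinverse L X) (hL : L.transpose = L) : L * X = X * L := by
  have h1 : L * X.transpose = X * L := by
    simpa [Matrix.transpose_mul, hL] using h.transpose_right
  have h2 : X * L * L = L := by
    have h2 := congrArg Matrix.transpose h.mul_mul_self
    rw [Matrix.transpose_mul, Matrix.transpose_mul, hL, ← Matrix.mul_assoc, h1] at h2
    exact h2
  calc L * X = X * L * L * X := by rw [h2]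
    _ = X * (L * (L * X)) := by simp only [Matrix.mul_assoc]
    _ = X * L := by rw [h.self_mul_self_mul hL]

theorem transpose_eq (h : IsPseudoinverse L X) (hL : L.transpose = L) : X.transpose = X := by
  have h1 : X.transpose * L = L * X := by
    simpa [Matrix.transpose_mul, hL] using h.transpose_left
  have h2 : L * X.transpose = X * L := by
    simpa [Matrix.transpose_mul, hL] using h.transpose_right
  have h3 := congrArg Matrix.transpose h.self_mul_mul
  rw [Matrix.transpose_mul, Matrix.transpose_mul, hL, ← Matrix.mul_assoc, h1, h.commute hL,
    Matrix.mul_assoc, h2, ← h.commute hL, ← Matrix.mul_assoc, h.self_mul_mul] at h3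
  exact h3.symm

end IsPseudoinverse

/-! ### Laplacian energy, effective resistance and unit balls -/

section Laplacian

variable {n : ℕ} (G : SimpleGraph (Fin n))

theorem laplacianPinv_spec : IsPseudoinverse (laplacian G) (laplacianPinv G) :=
  Classical.choose_spec (exists_isPseudoinverse (laplacian_isHermitian G))

theorem laplacian_transpose : (laplacian G).transpose = laplacian G := by
  simpa [Matrix.IsHermitian, Matrix.conjTranspose_eq_transpose_of_trivial] using
    laplacian_isHermitian G

theorem laplacianPinv_transpose : (laplacianPinv G).transpose = laplacianPinv G :=
  (laplacianPinv_spec G).transpose_eq (laplacian_transpose G)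

theorem laplacian_apply_of_ne {u v : Fin n} (h : u ≠ v) :
    laplacian G u v = open Classical in if G.Adj u v then -1 else 0 := by
  classical
  simp only [laplacian, SimpleGraph.lapMatrix, SimpleGraph.degMatrix, Matrix.sub_apply,
    Matrix.diagonal_apply_ne _ h, SimpleGraph.adjMatrix_apply]
  split_ifs <;> simp

theorem dotProduct_laplacian_mulVec (x : Fin n → ℝ) :
    x ⬝ᵥ laplacian G *ᵥ x =
      (∑ i, ∑ j, open Classical in if G.Adj i j then (x i - x j) ^ 2 else 0) / 2 := by
  classical
  rw [← SimpleGraph.lapMatrix_toLinearMap₂' ℝ G x, Matrix.toLinearMap₂'_apply']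
  simp only [laplacian]

theorem eq_of_laplacian_mulVec_eq_zero {x : Fin n → ℝ} (hx : laplacian G *ᵥ x = 0)
    {u v : Fin n} (h : G.Reachable u v) : x u = x v := by
  classical
  refine (SimpleGraph.lapMatrix_mulVec_eq_zero_iff_forall_reachable G).1 ?_ u v h
  rw [← hx]
  simp only [laplacian]

theorem laplacian_mulVec_eq_zero_of_dotProduct {x : Fin n → ℝ}
    (hx : x ⬝ᵥ laplacian G *ᵥ x = 0) : laplacian G *ᵥ x = 0 := by
  classical
  have h := (SimpleGraph.posSemidef_lapMatrix ℝ G).dotProduct_mulVec_zero_iff x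
  simp only [star_trivial] at h
  simp only [laplacian] at hx ⊢
  convert h.1 (by convert hx)

/-- A zero-sum vector supported on one component lies in the range of the Laplacian. -/
theorem laplacian_mulVec_pinv_mulVec {v : Fin n} {z : Fin n → ℝ}
    (hsupp : ∀ u, z u ≠ 0 → G.Reachable u v) (hsum : ∑ u, z u = 0) :
    laplacian G *ᵥ (laplacianPinv G *ᵥ z) = z := by
  set L := laplacian G
  set X := laplacianPinv G
  -- The residual lies in the kernel of `L`, so it is constant on the component and orthogonal to
  -- the zero-sum `z`; it is also orthogonal to the range of `L`. Hence `p ⬝ᵥ p = 0`.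
  set p := z - L *ᵥ (X *ᵥ z) with hp
  have hLp : L *ᵥ p = 0 := by
    rw [hp, Matrix.mulVec_sub, Matrix.mulVec_mulVec, Matrix.mulVec_mulVec,
      Matrix.mul_assoc, (laplacianPinv_spec G).self_mul_self_mul (laplacian_transpose G), sub_self]
  have hpz : p ⬝ᵥ z = 0 := by
    have : ∀ u, p u * z u = p v * z u := fun u => by
      by_cases hu : z u = 0
      · simp [hu]
      · rw [eq_of_laplacian_mulVec_eq_zero G hLp (hsupp u hu)]
    simp only [dotProduct, this, ← Finset.mul_sum, hsum, mul_zero]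
  have hpp : p ⬝ᵥ p = 0 := by
    have h1 : p ⬝ᵥ L *ᵥ (X *ᵥ z) = 0 := by
      rw [Matrix.dotProduct_mulVec, ← Matrix.mulVec_transpose, laplacian_transpose, hLp,
        zero_dotProduct]
    conv_lhs => rw [hp, dotProduct_sub, ← hp]
    rw [hpz, h1, sub_self]
  exact (sub_eq_zero.1 (dotProduct_self_eq_zero.1 hpp)).symm

/-- The quadratic form of the pseudoinverse, whose values at differences of unit vectors are the
effective resistances. -/
noncomputable def pinvResistance (u v : Fin n) : ℝ :=
  (Pi.single u 1 - Pi.single v 1 : Fin n → ℝ) ⬝ᵥ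
    laplacianPinv G *ᵥ (Pi.single u 1 - Pi.single v 1)

theorem pinvResistance_eq (u v : Fin n) : pinvResistance G u v =
    laplacianPinv G u u + laplacianPinv G v v - 2 * laplacianPinv G u v := by
  have h : laplacianPinv G v u = laplacianPinv G u v :=
    congrFun (congrFun (laplacianPinv_transpose G) u) v
  simp only [pinvResistance, Matrix.mulVec_sub, sub_dotProduct, dotProduct_sub,
    Matrix.mulVec_single_one, single_dotProduct, one_mul, Matrix.col_apply, h]
  ring

/-- The diagonal terms of `X a a + X b b - 2 X a b` depend on one index only, so the zero sums
annihilate them. -/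
theorem sum_mul_pinvResistance {y z : Fin n → ℝ} (hy : ∑ a, y a = 0) (hz : ∑ b, z b = 0) :
    ∑ a, ∑ b, y a * z b * pinvResistance G a b = -2 * (y ⬝ᵥ laplacianPinv G *ᵥ z) := by
  set X := laplacianPinv G
  have h : ∀ a, ∑ b, y a * z b * pinvResistance G a b =
      y a * X a a * ∑ b, z b + y a * (∑ b, z b * X b b) + -2 * (y a * ∑ b, X a b * z b) := by
    intro a
    simp only [pinvResistance_eq, Finset.mul_sum, ← Finset.sum_add_distrib]
    exact Finset.sum_congr rfl fun b _ => by ring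
  simp only [h, hz, mul_zero, zero_add, Finset.sum_add_distrib, ← Finset.sum_mul, hy, zero_mul,
    ← Finset.mul_sum]
  rfl

theorem effRes_of_reachable {u v : Fin n} (h : G.Reachable u v) :
    effRes G u v = (pinvResistance G u v : EReal) := by
  simp [effRes, h, pinvResistance]

theorem reachable_of_mem_erBall {u v : Fin n} (h : u ∈ erBall G v) : G.Reachable u v := by
  by_contra hn
  simp only [erBall, Set.mem_ofPred_eq, effRes, hn, if_false, top_le_iff] at h
  exact absurd h (by decide +revert)

theorem mem_erBall_self (v : Fin n) : v ∈ erBall G v := by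
  simp [erBall, effRes_of_reachable G (SimpleGraph.Reachable.refl v), pinvResistance]

/-- For the potential `x` of a unit flow from `u` to `v`, the resistance `r = x u - x v` is also the
energy of `x`. The edge `uv` alone contributes `r ^ 2` to it, so `r ^ 2 ≤ r`. -/
theorem mem_erBall_of_adj {u v : Fin n} (h : G.Adj u v) : u ∈ erBall G v := by
  classical
  rw [erBall, Set.mem_ofPred_eq, effRes_of_reachable G h.reachable]
  set y : Fin n → ℝ := Pi.single u 1 - Pi.single v 1 with hy
  set x := laplacianPinv G *ᵥ y with hx
  have hLx : laplacian G *ᵥ x = y := by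
    refine laplacian_mulVec_pinv_mulVec G (v := v) (fun w hw => ?_) (by simp [hy])
    by_cases hwu : w = u
    · exact hwu ▸ h.reachable
    by_cases hwv : w = v
    · rw [hwv]
    · simp [hy, hwu, hwv] at hw
  have hr : pinvResistance G u v = x u - x v := by
    change y ⬝ᵥ x = _
    simp [hy, sub_dotProduct]
  have hq : x u - x v = x ⬝ᵥ laplacian G *ᵥ x := by
    rw [hLx, dotProduct_comm]
    simp [hy, sub_dotProduct]
  have hge : (x u - x v) ^ 2 ≤ x ⬝ᵥ laplacian G *ᵥ x := by
    rw [dotProduct_laplacian_mulVec]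
    set F : Fin n → Fin n → ℝ := fun i j => if G.Adj i j then (x i - x j) ^ 2 else 0 with hF
    have hF0 : ∀ i j, 0 ≤ F i j := fun i j => by
      simp only [hF]; split_ifs <;> positivity
    have h1 : ∀ i j, F i j ≤ ∑ j, F i j := fun i j =>
      Finset.single_le_sum (f := F i) (fun j _ => hF0 i j) (Finset.mem_univ j)
    -- The edge occurs in the double sum as `(u, v)` and as `(v, u)`, which offsets the factor 1/2
    -- in the energy.
    have h2 : ∑ j, F u j + ∑ j, F v j ≤ ∑ i, ∑ j, F i j := by
      rw [← Finset.sum_pair (f := fun i => ∑ j, F i j) h.ne]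
      exact Finset.sum_le_sum_of_subset_of_nonneg (Finset.subset_univ _)
        fun i _ _ => Finset.sum_nonneg fun j _ => hF0 i j
    have h3 : F u v = (x u - x v) ^ 2 := by simp [hF, h]
    have h4 : F v u = (x u - x v) ^ 2 := by simp [hF, h.symm]; ring
    have := h1 u v
    have := h1 v u
    linarith
  rw [hr]
  have : x u - x v ≤ 1 := by nlinarith
  exact_mod_cast this

theorem sum_laplacian_col (v : Fin n) : ∑ u, (laplacian G *ᵥ Pi.single v 1) u = 0 := by
  classical
  have h : laplacian G *ᵥ (fun _ => 1) = 0 := by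
    simpa [laplacian] using SimpleGraph.lapMatrix_mulVec_const_eq_zero (R := ℝ) G
  have h2 := congrArg (fun w => (Pi.single v 1 : Fin n → ℝ) ⬝ᵥ w) h
  simp only [Matrix.dotProduct_mulVec, ← Matrix.mulVec_transpose, laplacian_transpose,
    dotProduct_zero] at h2
  simpa [dotProduct] using h2

theorem mem_erBall_of_laplacian_col_ne_zero {u v : Fin n}
    (h : (laplacian G *ᵥ Pi.single v 1) u ≠ 0) : u ∈ erBall G v := by
  by_cases huv : u = v
  · exact huv ▸ mem_erBall_self G v
  · rw [Matrix.mulVec_single_one, Matrix.col_apply, laplacian_apply_of_ne G huv] at h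
    exact mem_erBall_of_adj G (by by_contra hn; simp [hn] at h)

/-- The effective resistances inside the unit ball of `v` determine the neighbors of `v`. -/
theorem adj_iff_of_effRes_eq {G H : SimpleGraph (Fin n)} {v : Fin n}
    (hball : erBall G v = erBall H v)
    (hres : ∀ a ∈ erBall G v, ∀ b ∈ erBall G v, effRes G a b = effRes H a b) (u : Fin n) :
    G.Adj v u ↔ H.Adj v u := by
  set yG := laplacian G *ᵥ (Pi.single v 1 : Fin n → ℝ) with hyG
  set yH := laplacian H *ᵥ (Pi.single v 1 : Fin n → ℝ) with hyH
  have sG : ∀ a, yG a ≠ 0 → a ∈ erBall G v := fun a => mem_erBall_of_laplacian_col_ne_zero G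
  have sH : ∀ a, yH a ≠ 0 → a ∈ erBall G v := fun a ha =>
    hball ▸ mem_erBall_of_laplacian_col_ne_zero H ha
  set w := yG - yH with hw
  have sw : ∀ a, w a ≠ 0 → a ∈ erBall G v := fun a ha => by
    by_contra hn
    have h1 : yG a = 0 := by by_contra h; exact hn (sG a h)
    have h2 : yH a = 0 := by by_contra h; exact hn (sH a h)
    exact ha (by simp [hw, h1, h2])
  have zG : ∑ a, yG a = 0 := sum_laplacian_col G v
  have zH : ∑ a, yH a = 0 := sum_laplacian_col H v
  have zw : ∑ a, w a = 0 := by simp [hw, zG, zH]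
  have hform : ∀ y : Fin n → ℝ, (∀ a, y a ≠ 0 → a ∈ erBall G v) → ∑ a, y a = 0 →
      y ⬝ᵥ laplacianPinv G *ᵥ w = y ⬝ᵥ laplacianPinv H *ᵥ w := by
    intro y sy zy
    have h1 := sum_mul_pinvResistance G zy zw
    have h2 := sum_mul_pinvResistance H zy zw
    have h3 : ∑ a, ∑ b, y a * w b * pinvResistance G a b =
        ∑ a, ∑ b, y a * w b * pinvResistance H a b := by
      refine Finset.sum_congr rfl fun a _ => Finset.sum_congr rfl fun b _ => ?_
      by_cases ha : y a = 0
      · simp [ha]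
      by_cases hb : w b = 0
      · simp [hb]
      have ma := sy a ha
      have mb := sw b hb
      have h := hres a ma b mb
      rw [effRes_of_reachable G
        ((reachable_of_mem_erBall G ma).trans (reachable_of_mem_erBall G mb).symm)] at h
      rw [hball] at ma mb
      rw [effRes_of_reachable H
        ((reachable_of_mem_erBall H ma).trans (reachable_of_mem_erBall H mb).symm)] at h
      rw [EReal.coe_injective h]
    linarith
  have hwG : laplacian G *ᵥ (laplacianPinv G *ᵥ w) = w :=
    laplacian_mulVec_pinv_mulVec G (fun a ha => reachable_of_mem_erBall G (sw a ha)) zw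
  have hwH : laplacian H *ᵥ (laplacianPinv H *ᵥ w) = w :=
    laplacian_mulVec_pinv_mulVec H
      (fun a ha => reachable_of_mem_erBall H (hball ▸ sw a ha)) zw
  -- By symmetry of the Laplacian, pairing with its column at `v` evaluates `L x` at `v`.
  have eval : ∀ (K : SimpleGraph (Fin n)) (x : Fin n → ℝ),
      (laplacian K *ᵥ (Pi.single v 1 : Fin n → ℝ)) ⬝ᵥ x = (laplacian K *ᵥ x) v := by
    intro K x
    rw [dotProduct_comm, Matrix.dotProduct_mulVec, ← Matrix.mulVec_transpose,
      laplacian_transpose, dotProduct_comm]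
    simp
  have hzero : w ⬝ᵥ laplacianPinv G *ᵥ w = 0 := by
    conv_lhs => rw [hw, sub_dotProduct, ← hw]
    rw [hform yH sH zH, eval G, eval H, hwG, hwH, sub_self]
  -- With `x = L⁺ w` and `L x = w`, the energy of `x` is `x ⬝ᵥ w = 0`, which forces `L x = 0`.
  have hw0 : w = 0 := by
    rw [← hwG]
    refine laplacian_mulVec_eq_zero_of_dotProduct G ?_
    rw [hwG, dotProduct_comm, hzero]
  by_cases huv : u = v
  · simp [huv]
  have h := congrFun (sub_eq_zero.1 hw0) u
  simp only [hyG, hyH, Matrix.mulVec_single_one, Matrix.col_apply,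
    laplacian_apply_of_ne _ huv] at h
  rw [G.adj_comm, H.adj_comm]
  by_cases h1 : G.Adj u v <;> by_cases h2 : H.Adj u v <;> simp_all

end Laplacian

/-! ### Incidence lists -/

/-- The incidence lists of `G` in increasing order. -/
noncomputable def sortedIncidence {n : ℕ} (d : ℕ) (G : SimpleGraph (Fin n)) (q : Fin n × Fin d) :
    Option (Fin n) :=
  open Classical in ((Finset.univ.filter (G.Adj q.1)).sort (· ≤ ·))[(q.2 : ℕ)]?

theorem isIncidenceFunction_sortedIncidence {n d : ℕ} {G : SimpleGraph (Fin n)}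
    (hG : DegreeAtMost d G) : IsIncidenceFunction G (sortedIncidence d G) := by
  classical
  refine ⟨fun v u => ?_, fun v i j u hi hj => ?_, fun v i j hij hi => ?_⟩
  · have hlen : ((Finset.univ.filter (G.Adj v)).sort (· ≤ ·)).length ≤ d := by
      rw [Finset.length_sort, ← Set.ncard_coe_finset]
      convert hG v
      ext w
      simp
    have hmem : G.Adj v u ↔ u ∈ (Finset.univ.filter (G.Adj v)).sort (· ≤ ·) := by simp
    rw [hmem, List.mem_iff_getElem?]
    constructor
    · rintro ⟨i, hi⟩
      have hlt := (List.getElem?_eq_some_iff.1 hi).1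
      refine ⟨⟨i, hlt.trans_le hlen⟩, ?_⟩
      simp only [sortedIncidence]
      convert hi
    · rintro ⟨i, hi⟩
      refine ⟨i, ?_⟩
      simp only [sortedIncidence] at hi
      convert hi
  · simp only [sortedIncidence] at hi hj
    have hlt := (List.getElem?_eq_some_iff.1 hi).1
    exact Fin.ext ((List.getElem?_inj hlt (Finset.sort_nodup _ _)).1 (hi.trans hj.symm))
  · simp only [sortedIncidence, List.getElem?_eq_none_iff] at hi ⊢
    exact hi.trans hij

/-- A tester must work for every ordering of the lists; the increasing one is convenient because it
depends only on the set of neighbors. -/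
theorem sortedIncidence_congr {n d : ℕ} {G H : SimpleGraph (Fin n)} {v : Fin n}
    (h : ∀ u, G.Adj v u ↔ H.Adj v u) (i : Fin d) :
    sortedIncidence d G (v, i) = sortedIncidence d H (v, i) := by
  classical
  have : G.Adj v = H.Adj v := funext fun u => propext (h u)
  simp only [sortedIncidence, this]

/-! ### Simulation of oracles -/

namespace OracleAlg

/-- Replaces every query `q` by the subroutine `sub q`, which passes its result on. -/
def simulate {Q R Q' R' β : Type} (sub : Q → (R → OracleAlg Q' R' β) → OracleAlg Q' R' β) :
    OracleAlg Q R β → OracleAlg Q' R' β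
  | halt b => halt b
  | step next => step (next.simulate sub)
  | random k next => random k fun i => (next i).simulate sub
  | query q next => sub q fun r => (next r).simulate sub

theorem output_simulate {Q R Q' R' β : Type}
    {sub : Q → (R → OracleAlg Q' R' β) → OracleAlg Q' R' β} {g : Q → R} {O : Q' → R'}
    (h : ∀ q k, (sub q k).output O = (k (g q)).output O) (A : OracleAlg Q R β) :
    (A.simulate sub).output O = A.output g := by
  induction A with
  | halt b => rfl
  | step next ih => exact ih
  | random k next ih => simp only [simulate, output, ih]
  | query q next ih => simp only [simulate, output, h, ih]

/-- Only queries cost `N`, but charging `N` to every unit of time gives a bound in terms of the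
running time. -/
theorem queries_simulate_le {Q R Q' R' β : Type}
    {sub : Q → (R → OracleAlg Q' R' β) → OracleAlg Q' R' β} {g : Q → R} {O : Q' → R'} {N : ℕ}
    (h : ∀ q k, (sub q k).queries O ≤ N + (k (g q)).queries O) (A : OracleAlg Q R β) :
    (A.simulate sub).queries O ≤ A.time g * N := by
  induction A with
  | halt b => simp [simulate, queries]
  | step next ih =>
    simp only [simulate, queries, time]
    exact ih.trans (Nat.mul_le_mul_right _ (Nat.le_succ _))
  | random k next ih =>
    simp only [simulate, queries, time]
    refine Finset.sup_le fun i hi => (ih i).trans (Nat.mul_le_mul_right _ ?_)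
    exact (Finset.le_sup (f := fun i => (next i).time g) hi).trans (Nat.le_succ _)
  | query q next ih =>
    simp only [simulate, time]
    refine (h q _).trans ?_
    have := ih (g q)
    rw [add_mul, one_mul]
    omega

/-- Queries all elements of `l` and passes on the table `T`, updated by the answers. -/
def ask {Q R β : Type} [DecidableEq Q] :
    List Q → (Q → R) → ((Q → R) → OracleAlg Q R β) → OracleAlg Q R β
  | [], T, k => k T
  | q :: l, T, k => query q fun r => ask l (Function.update T q r) k

/-- The table `T`, updated by the answers of `O` to the queries in `l`. -/
def updateTable {Q R : Type} [DecidableEq Q] (O : Q → R) (l : List Q) (T : Q → R) (x : Q) : R :=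
  if x ∈ l then O x else T x

theorem updateTable_nil {Q R : Type} [DecidableEq Q] (O T : Q → R) : updateTable O [] T = T := by
  funext x
  simp [updateTable]

theorem updateTable_cons {Q R : Type} [DecidableEq Q] (O T : Q → R) (q : Q) (l : List Q) :
    updateTable O (q :: l) T = updateTable O l (Function.update T q (O q)) := by
  funext x
  by_cases hx : x = q
  · subst hx; simp [updateTable]
  · simp [updateTable, hx]

theorem output_ask {Q R β : Type} [DecidableEq Q] (O : Q → R) (l : List Q) (T : Q → R)
    (k : (Q → R) → OracleAlg Q R β) :
    (ask l T k).output O = (k (updateTable O l T)).output O := by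
  induction l generalizing T with
  | nil => simp [ask, updateTable_nil]
  | cons q l ih => rw [ask, output, ih, updateTable_cons]

theorem queries_ask {Q R β : Type} [DecidableEq Q] (O : Q → R) (l : List Q) (T : Q → R)
    (k : (Q → R) → OracleAlg Q R β) :
    (ask l T k).queries O = l.length + (k (updateTable O l T)).queries O := by
  induction l generalizing T with
  | nil => simp [ask, updateTable_nil]
  | cons q l ih => rw [ask, queries, ih, updateTable_cons, List.length_cons]; omega

end OracleAlg

/-! ### Recovering incidence lists from resistance tables -/

section Subroutine

variable {n : ℕ}

/-- The pairs `(u, v)` for all `u`. -/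
def rowPairs (v : Fin n) : List (Fin n × Fin n) :=
  (List.finRange n).map fun u => (u, v)

/-- The ball around `v` according to the resistance table `T`. -/
noncomputable def tableBall (T : Fin n × Fin n → EReal) (v : Fin n) : Finset (Fin n) :=
  open Classical in Finset.univ.filter fun u => T (u, v) ≤ 1

/-- The pairs of vertices in the ball around `v` according to `T`. -/
noncomputable def ballPairs (T : Fin n × Fin n → EReal) (v : Fin n) : List (Fin n × Fin n) :=
  (tableBall T v ×ˢ tableBall T v).toList

/-- The table obtained by querying the row of `v`. -/
noncomputable def rowTable (O : Fin n × Fin n → EReal) (v : Fin n) : Fin n × Fin n → EReal :=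
  -- The default `⊤` is immaterial: the ball is read off the row of `v`, which is queried
  -- completely.
  OracleAlg.updateTable O (rowPairs v) fun _ => ⊤

/-- The table obtained by querying the row of `v` and then all pairs in the ball around `v`. -/
noncomputable def ballTable (O : Fin n × Fin n → EReal) (v : Fin n) : Fin n × Fin n → EReal :=
  OracleAlg.updateTable O (ballPairs (rowTable O v) v) (rowTable O v)

/-- An entry of the incidence lists of a graph that is consistent with the table `T`. -/
noncomputable def decodeTable (d : ℕ) (T : Fin n × Fin n → EReal) (q : Fin n × Fin d) : Option (Fin n) :=
  open Classical in
  -- Decoding by choice makes no queries. For a table that comes from a graph, that graph is a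
  -- witness, so `none` is never reached through this test.
  if h : ∃ H : SimpleGraph (Fin n), ballTable (erOracle H) q.1 = T then
    sortedIncidence d h.choose q
  else none

/-- Finds an entry of the incidence lists by effective resistance queries. -/
noncomputable def incidenceSubroutine {β : Type} (d : ℕ) (q : Fin n × Fin d)
    (k : Option (Fin n) → OracleAlg (Fin n × Fin n) EReal β) :
    OracleAlg (Fin n × Fin n) EReal β :=
  OracleAlg.ask (rowPairs q.1) (fun _ => ⊤) fun T =>
    OracleAlg.ask (ballPairs T q.1) T fun T' => k (decodeTable d T' q)

theorem mem_rowPairs (u v : Fin n) : (u, v) ∈ rowPairs v := by simp [rowPairs]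

theorem coe_tableBall_rowTable (G : SimpleGraph (Fin n)) (v : Fin n) :
    (tableBall (rowTable (erOracle G) v) v : Set (Fin n)) = erBall G v := by
  ext u
  simp [tableBall, rowTable, OracleAlg.updateTable, mem_rowPairs, erOracle, erBall]

theorem mem_ballPairs_rowTable {G : SimpleGraph (Fin n)} {v a b : Fin n} :
    (a, b) ∈ ballPairs (rowTable (erOracle G) v) v ↔ a ∈ erBall G v ∧ b ∈ erBall G v := by
  simp [ballPairs, ← coe_tableBall_rowTable G v]

theorem length_ballPairs_rowTable_le (G : SimpleGraph (Fin n)) (v : Fin n) :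
    (ballPairs (rowTable (erOracle G) v) v).length ≤ erDensity G ^ 2 := by
  rw [ballPairs, Finset.length_toList, Finset.card_product, ← Set.ncard_coe_finset,
    coe_tableBall_rowTable, sq]
  have h : (erBall G v).ncard ≤ erDensity G :=
    Finset.le_sup (f := fun v => (erBall G v).ncard) (Finset.mem_univ v)
  exact Nat.mul_le_mul h h

theorem ballTable_row (G : SimpleGraph (Fin n)) (u v : Fin n) :
    ballTable (erOracle G) v (u, v) = effRes G u v := by
  simp [ballTable, rowTable, OracleAlg.updateTable, mem_rowPairs, erOracle]

theorem ballTable_ball {G : SimpleGraph (Fin n)} {v a b : Fin n} (ha : a ∈ erBall G v)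
    (hb : b ∈ erBall G v) : ballTable (erOracle G) v (a, b) = effRes G a b := by
  rw [ballTable, OracleAlg.updateTable, if_pos (mem_ballPairs_rowTable.2 ⟨ha, hb⟩), erOracle]

/-- The chosen graph may differ from `G` elsewhere, but equal tables give equal balls and equal
resistances inside them, hence the same neighbors of `q.1`. -/
theorem decodeTable_ballTable (d : ℕ) (G : SimpleGraph (Fin n)) (q : Fin n × Fin d) :
    decodeTable d (ballTable (erOracle G) q.1) q = sortedIncidence d G q := by
  obtain ⟨v, i⟩ := q
  have h : ∃ H : SimpleGraph (Fin n), ballTable (erOracle H) v = ballTable (erOracle G) v :=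
    ⟨G, rfl⟩
  rw [decodeTable, dif_pos h]
  have hH := h.choose_spec
  set H := h.choose
  have hball : erBall H v = erBall G v := by
    ext u
    simp only [erBall, Set.mem_ofPred_eq, ← ballTable_row, hH]
  refine sortedIncidence_congr (adj_iff_of_effRes_eq hball fun a ha b hb => ?_) i
  rw [← ballTable_ball ha hb, hH, ballTable_ball (hball ▸ ha) (hball ▸ hb)]

theorem output_incidenceSubroutine {β : Type} (d : ℕ) (G : SimpleGraph (Fin n))
    (q : Fin n × Fin d) (k : Option (Fin n) → OracleAlg (Fin n × Fin n) EReal β) :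
    (incidenceSubroutine d q k).output (erOracle G) =
      (k (sortedIncidence d G q)).output (erOracle G) := by
  rw [← decodeTable_ballTable, incidenceSubroutine, OracleAlg.output_ask, OracleAlg.output_ask]
  rfl

theorem queries_incidenceSubroutine_le {β : Type} (d : ℕ) (G : SimpleGraph (Fin n))
    (q : Fin n × Fin d) (k : Option (Fin n) → OracleAlg (Fin n × Fin n) EReal β) :
    (incidenceSubroutine d q k).queries (erOracle G) ≤
      (n + erDensity G ^ 2) + (k (sortedIncidence d G q)).queries (erOracle G) := by
  rw [← decodeTable_ballTable, incidenceSubroutine, OracleAlg.queries_ask,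
    OracleAlg.queries_ask, ← add_assoc]
  refine Nat.add_le_add (Nat.add_le_add ?_ (length_ballPairs_rowTable_le G q.1)) le_rfl
  simp [rowPairs]

end Subroutine

theorem mainTheorem3 :
    ∃ C : ℝ, 0 < C ∧
      ∀ (d : ℕ) (P : GraphProperty) (c s : ℝ≥0∞) (f : ℝ → ℕ → ℝ) (A : BoundedDegreeAlg d),
        IsBoundedDegreeTester d P c s A → HasRunningTime d A f →
          ∃ B : ERAlg, IsERTester d P c s B ∧
            ∀ (n : ℕ) (ε : ℝ), 0 < ε → ∀ G : SimpleGraph (Fin n), DegreeAtMost d G →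
              ((B n ε).queries (erOracle G) : ℝ) ≤
                C * (f ε n * ((n : ℝ) + (erDensity G : ℝ) ^ 2)) := by
  refine ⟨1, one_pos, fun d P c s f A hA hf =>
    ⟨fun n ε => (A n ε).simulate (incidenceSubroutine d), fun n ε hε G hG => ?_,
      fun n ε hε G hG => ?_⟩⟩
  · have h := hA n ε hε G hG _ (isIncidenceFunction_sortedIncidence hG)
    -- The simulation preserves the output distribution exactly, so `c` and `s` carry over
    -- unchanged.
    rwa [← OracleAlg.output_simulate (output_incidenceSubroutine d G) (A n ε)] at h
  · have h := OracleAlg.queries_simulate_le (queries_incidenceSubroutine_le d G) (A n ε)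
    have ht := hf n ε hε G hG _ (isIncidenceFunction_sortedIncidence hG)
    rw [one_mul]
    calc (((A n ε).simulate (incidenceSubroutine d)).queries (erOracle G) : ℝ)
        ≤ ((A n ε).time (sortedIncidence d G) * (n + erDensity G ^ 2) : ℕ) := by exact_mod_cast h
      _ = ((A n ε).time (sortedIncidence d G) : ℝ) * ((n : ℝ) + (erDensity G : ℝ) ^ 2) := by
        push_cast; ring
      _ ≤ _ := mul_le_mul_of_nonneg_right ht (by positivity)
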